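/- Let $n\ge 0$ and let $\pi=\pi_1\pi_2\cdots\pi_n$ be a permutation of $\{1,\dots,n\}$ that avoids $231$, i.e. there are no $a<b<c$ with $\pi_c<\pi_a<\pi_b$. Let $s_i=(i,i+1)$ for $1\le i\le n-1$. A reduced word of $\pi$ is a word $i_1i_2\cdots i_k$ with $\pi=s_{i_1}s_{i_2}\cdots s_{i_k}$ and $k$ as small as possible. Let $G_\pi$ be the graph whose vertices are the reduced words of $\pi$, two of them being adjacent if one is obtained from the other by a single commutation move (adjacent letters $jk$ with $|j-k|>1$ are replaced by $kj$) or a single long braid move (consecutive letters $j(j+1)j$ are replaced by $(j+1)j(j+1)$, or vice versa). In $\mathbb R^n$ consider the hyperplanes $H_{ij}=\{x: x_i=x_j\}$, $1\le i<j\le n$, the chamber $c_0=\{x: x_1<x_2<\cdots<x_n\}$, and the chamber $\pi(c_0)$, where $\pi$ acts by permuting coordinates, $(\pi x)_{\pi_i}=x_i$. Let $L_2(\pi)$ be the set of all subspaces $X=H\cap K$, with $H\ne K$ two of these hyperplanes, such that every $H_{ij}$ containing $X$ separates $c_0$ from $\pi(c_0)$. (Equivalently, $|L_2(\pi)|$ is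 the number of unordered pairs of inversions of $\pi$ with no common index plus the number of $321$ patterns in $\pi$.) Then $G_\pi$ has finite diameter, and $$\operatorname{diam}(G_\pi)=|L_2(\pi)|.$$ -/

import Mathlib

/-! Permutations of `{1, …, n}` are elements of `Equiv.Perm (Fin n)`, so positions, values and
letters of words are counted from `0` instead of from `1`. Products of permutations are composed
from right to left. -/

namespace RedWord

/-- The simple reflection `s_i`, interchanging `i` and `i + 1`. The `n - 1` simple reflections
are indexed by `Fin (n - 1)`; there are none for `n = 0` and for `n = 1`. -/
def simpleRefl {n : ℕ} (i : Fin (n - 1)) : Equiv.Perm (Fin n) :=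
  Equiv.swap ⟨i.val, by omega⟩ ⟨i.val + 1, by omega⟩

/-- The permutation `s_{i₁} s_{i₂} ⋯ s_{i_k}` represented by the word `i₁ i₂ ⋯ i_k`. -/
def wordProd {n : ℕ} (w : List (Fin (n - 1))) : Equiv.Perm (Fin n) :=
  (w.map simpleRefl).prod

/-- `w` is a reduced word for `π`: it represents `π`, and it does so with the least number of
letters. -/
def IsReducedWord {n : ℕ} (π : Equiv.Perm (Fin n)) (w : List (Fin (n - 1))) : Prop :=
  wordProd w = π ∧ ∀ v : List (Fin (n - 1)), wordProd v = π → w.length ≤ v.length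

/-- A commutation move: two adjacent letters `j k` with `|j - k| > 1` are exchanged. -/
def CommMove {m : ℕ} (u v : List (Fin m)) : Prop :=
  ∃ (a b : List (Fin m)) (j k : Fin m), (j.val + 1 < k.val ∨ k.val + 1 < j.val) ∧
    u = a ++ [j, k] ++ b ∧ v = a ++ [k, j] ++ b

/-- A long braid move: consecutive letters `j k j` with `k = j + 1` or `j = k + 1` are replaced
by `k j k`. -/
def LongBraidMove {m : ℕ} (u v : List (Fin m)) : Prop :=
  ∃ (a b : List (Fin m)) (j k : Fin m), (k.val = j.val + 1 ∨ j.val = k.val + 1) ∧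
    u = a ++ [j, k, j] ++ b ∧ v = a ++ [k, j, k] ++ b

theorem CommMove.symm {m : ℕ} {u v : List (Fin m)} (h : CommMove u v) : CommMove v u := by
  obtain ⟨a, b, j, k, hjk, hu, hv⟩ := h
  exact ⟨a, b, k, j, hjk.symm, hv, hu⟩

theorem LongBraidMove.symm {m : ℕ} {u v : List (Fin m)} (h : LongBraidMove u v) :
    LongBraidMove v u := by
  obtain ⟨a, b, j, k, hjk, hu, hv⟩ := h
  exact ⟨a, b, k, j, hjk.symm, hv, hu⟩

theorem CommMove.ne {m : ℕ} {u v : List (Fin m)} (h : CommMove u v) : u ≠ v := by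
  obtain ⟨a, b, j, k, hjk, rfl, rfl⟩ := h
  intro h
  simp at h
  obtain ⟨rfl, -⟩ := h
  omega

theorem LongBraidMove.ne {m : ℕ} {u v : List (Fin m)} (h : LongBraidMove u v) : u ≠ v := by
  obtain ⟨a, b, j, k, hjk, rfl, rfl⟩ := h
  intro h
  simp at h
  obtain ⟨rfl, -⟩ := h
  omega

/-- The graph `G_π` on the set `R(π)` of reduced words for `π`: two reduced words are adjacent
when they differ by a single commutation move or a single long braid move. -/
def reducedWordGraph {n : ℕ} (π : Equiv.Perm (Fin n)) :
    SimpleGraph {w : List (Fin (n - 1)) // IsReducedWord π w} where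
  Adj u v := CommMove u.1 v.1 ∨ LongBraidMove u.1 v.1
  symm := ⟨fun _ _ h => h.imp CommMove.symm LongBraidMove.symm⟩
  loopless := ⟨fun _ h => h.elim (fun h => h.ne rfl) (fun h => h.ne rfl)⟩

/-- Two sequences of the same length are order isomorphic. -/
def OrderIsomorphic {k : ℕ} {α β : Type*} [LE α] [LE β] (u : Fin k → α) (v : Fin k → β) : Prop :=
  ∀ a b : Fin k, u a ≤ u b ↔ v a ≤ v b

/-- `π` contains the pattern `σ₁ σ₂ ⋯ σ_k`: some subsequence of `π₁ π₂ ⋯ π_n` is order isomorphic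
to it. -/
def ContainsPattern {n k : ℕ} (π : Equiv.Perm (Fin n)) (σ : Fin k → ℕ) : Prop :=
  ∃ f : Fin k → Fin n, StrictMono f ∧ OrderIsomorphic (fun a => π (f a)) σ

/-- `π` avoids the pattern `σ₁ σ₂ ⋯ σ_k`. -/
def AvoidsPattern {n k : ℕ} (π : Equiv.Perm (Fin n)) (σ : Fin k → ℕ) : Prop :=
  ¬ ContainsPattern π σ

/-! The reflection arrangement of type `A_{n-1}`, written in `ℝⁿ`. All its intersection subspaces
contain the line spanned by `(1, …, 1)`, and they correspond to those of the essential arrangement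
in the quotient of `ℝⁿ` by this line. -/

/-- The hyperplane `H_{ij} = {x | x_i = x_j}`. -/
def hyperplane {n : ℕ} (i j : Fin n) : Submodule ℝ (Fin n → ℝ) where
  carrier := {x | x i = x j}
  add_mem' := by
    intro x y hx hy
    change x i + y i = x j + y j
    rw [show x i = x j from hx, show y i = y j from hy]
  zero_mem' := rfl
  smul_mem' := by
    intro c x hx
    change c * x i = c * x j
    rw [show x i = x j from hx]

/-- The hyperplanes of the arrangement, `L_1 = {H_{ij} | i < j}`. -/
def arrangement (n : ℕ) : Set (Submodule ℝ (Fin n → ℝ)) :=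
  {H | ∃ i j : Fin n, i < j ∧ H = hyperplane i j}

/-- The set `L_2` of all codimension-two intersection subspaces of the arrangement. -/
def codimTwo (n : ℕ) : Set (Submodule ℝ (Fin n → ℝ)) :=
  {X | ∃ H ∈ arrangement n, ∃ K ∈ arrangement n, H ≠ K ∧ X = H ⊓ K}

/-- The base chamber `c₀ = {x | x₁ < x₂ < ⋯ < x_n}`. -/
def baseChamber (n : ℕ) : Set (Fin n → ℝ) := {x | StrictMono x}

/-- The chamber `π(c₀)`, where `π` acts on `ℝⁿ` by permuting coordinates:
`(π x)_{π(i)} = x_i`. -/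
def permChamber {n : ℕ} (π : Equiv.Perm (Fin n)) : Set (Fin n → ℝ) :=
  (fun x : Fin n → ℝ => fun i => x (π.symm i)) '' baseChamber n

/-- The hyperplane `H` separates `C` from `D`: the two sets lie strictly on opposite sides
of `H`. -/
def Separates {n : ℕ} (H : Submodule ℝ (Fin n → ℝ)) (C D : Set (Fin n → ℝ)) : Prop :=
  ∃ f : (Fin n → ℝ) →ₗ[ℝ] ℝ, LinearMap.ker f = H ∧ (∀ x ∈ C, f x < 0) ∧ ∀ y ∈ D, 0 < f y

/-- `L_1(π)`: the hyperplanes of the arrangement that separate `c₀` from `π(c₀)`. -/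
def sepHyperplanes {n : ℕ} (π : Equiv.Perm (Fin n)) : Set (Submodule ℝ (Fin n → ℝ)) :=
  {H | H ∈ arrangement n ∧ Separates H (baseChamber n) (permChamber π)}

/-- `L_2(π)`: the codimension-two intersection subspaces `X` such that every hyperplane of the
arrangement that contains `X` separates `c₀` from `π(c₀)`. -/
def sepCodimTwo {n : ℕ} (π : Equiv.Perm (Fin n)) : Set (Submodule ℝ (Fin n → ℝ)) :=
  {X | X ∈ codimTwo n ∧ ∀ H ∈ arrangement n, X ≤ H → H ∈ sepHyperplanes π}

end RedWord

/-! A reduced word of `π` is a minimal gallery from `c₀` to `π(c₀)`, and it is determined by the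
order in which the gallery crosses the hyperplanes that separate the two chambers, that is, the
inversions of `π`. Each subspace in `L_2(π)` is met in one of two directions, and a move reverses
the direction of exactly one of them, so the number of subspaces met in the increasing direction
is a height function on `G_π` that changes by one along every edge.

If the larger values of the crossings are not weakly increasing along a word, a move that raises
the height is possible at the first descent: in the braid case, the hyperplane that the move needs
just before the descent was crossed earlier, and since the crossings so far are sorted it was
crossed last. The same argument at the last ascent lowers the height unless these values are
weakly decreasing, and here avoiding `231` ensures that the hyperplane needed just after the
ascent is still to be crossed. As a word is determined by the larger values of its crossings,
there are a unique word `s` at the top, of height `N = |L_2(π)|`, and a unique word `r` at the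
bottom, of height `0`. Hence `d(v, r) + d(v, s) = N` for every `v`; adding up these equations for
`u` and `v` and using the triangle inequality gives `d(u, v) ≤ N`, with equality for `r` and
`s`. -/

namespace RedWord

section PairCount

variable {α : Type*}

/-- The number of pairs of entries of a list, `a` before `b`, with `R a b`. -/
def pairCount (R : α → α → Prop) [DecidableRel R] : List α → ℕ
  | [] => 0
  | a :: l => l.countP (R a ·) + pairCount R l

variable (R : α → α → Prop) [DecidableRel R]

theorem pairCount_append_swap (A : List α) (p q : α) (B : List α) :
    pairCount R (A ++ p :: q :: B) + (if R q p then 1 else 0) =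
      pairCount R (A ++ q :: p :: B) + (if R p q then 1 else 0) := by
  induction A with
  | nil =>
    simp only [List.nil_append, pairCount, List.countP_cons, decide_eq_true_eq]
    omega
  | cons a A ih =>
    have hperm : (A ++ p :: q :: B).Perm (A ++ q :: p :: B) := (List.Perm.swap q p B).append_left A
    simp only [List.cons_append, pairCount, hperm.countP_eq]
    omega

theorem pairCount_append_reverse_three (A : List α) {p q r : α} (B : List α)
    (hpq : ¬ R p q) (hqp : ¬ R q p) (hqr : ¬ R q r) (hrq : ¬ R r q) :
    pairCount R (A ++ p :: q :: r :: B) + (if R r p then 1 else 0) =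
      pairCount R (A ++ r :: q :: p :: B) + (if R p r then 1 else 0) := by
  have h₁ := pairCount_append_swap R A p q (r :: B)
  have h₂ := pairCount_append_swap R (A ++ [q]) p r B
  have h₃ := pairCount_append_swap R A q r (p :: B)
  simp only [hpq, hqp, hqr, hrq, if_false, List.append_assoc, List.singleton_append] at h₁ h₂ h₃
  omega

theorem pairCount_eq_zero_iff {l : List α} :
    pairCount R l = 0 ↔ l.Pairwise fun a b => ¬ R a b := by
  induction l with
  | nil => simp [pairCount]
  | cons a l ih => simp [pairCount, ih, List.countP_eq_zero]

theorem countP_eq_sum_toFinset [DecidableEq α] {l : List α} (hl : l.Nodup) (p : α → Prop)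
    [DecidablePred p] : l.countP (p ·) = ∑ a ∈ l.toFinset, if p a then 1 else 0 := by
  rw [List.sum_toFinset _ hl]
  induction l with
  | nil => rfl
  | cons a l ih => simp [List.countP_cons, ih hl.of_cons, add_comm]

theorem pairCount_add_pairCount_swap [DecidableEq α] [Std.Irrefl R] {l : List α} (hl : l.Nodup) :
    pairCount R l + pairCount (fun a b => R b a) l =
      ((l.toFinset ×ˢ l.toFinset).filter fun p => R p.1 p.2).card := by
  rw [Finset.card_filter, Finset.sum_product]
  induction l with
  | nil => rfl
  | cons a l ih =>
    rw [List.nodup_cons] at hl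
    have ha : a ∉ l.toFinset := by simpa using hl.1
    have hirrefl : ¬ R a a := Std.Irrefl.irrefl a
    have hafter := countP_eq_sum_toFinset hl.2 (R a ·)
    have hbefore := countP_eq_sum_toFinset hl.2 (R · a)
    simp only [List.toFinset_cons, Finset.sum_insert ha, Finset.sum_add_distrib, pairCount,
      hirrefl, if_false]
    have hrest := ih hl.2
    dsimp only at hrest
    omega

end PairCount

section Descent

variable {α : Type*} {r : α → α → Prop}

theorem exists_first_not_rel (l : List α) (h : ¬ l.IsChain r) :
    ∃ A p q B, l = A ++ p :: q :: B ∧ ¬ r p q ∧ (A ++ [p]).IsChain r := by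
  induction l using List.reverseRecOn with
  | nil => exact absurd .nil h
  | append_singleton l x ih =>
    by_cases hl : l.IsChain r
    · rcases List.eq_nil_or_concat' l with rfl | ⟨A, p, rfl⟩
      · exact absurd (.singleton x) h
      · refine ⟨A, p, x, [], by simp, fun hpx => h ?_, hl⟩
        rw [List.append_assoc, List.singleton_append, List.isChain_split]
        exact ⟨hl, List.isChain_pair.2 hpx⟩
    · obtain ⟨A, p, q, B, rfl, hpq, hA⟩ := ih hl
      exact ⟨A, p, q, B ++ [x], by simp, hpq, hA⟩

theorem exists_last_not_rel (l : List α) (h : ¬ l.IsChain r) :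
    ∃ A p q B, l = A ++ p :: q :: B ∧ ¬ r p q ∧ (q :: B).IsChain r := by
  rw [← List.isChain_reverse (R := fun a b => r b a)] at h
  obtain ⟨A, q, p, B, hl, hpq, hA⟩ := exists_first_not_rel _ h
  refine ⟨B.reverse, p, q, A.reverse, ?_, hpq, ?_⟩
  · rw [← l.reverse_reverse, hl]
    simp
  · rw [← List.isChain_reverse]
    simpa using hA

end Descent

section Diameter

variable {V : Type*} {G : SimpleGraph V}

theorem ediam_eq_of_edist_add_edist_eq {r s : V} {N : ℕ∞}
    (h : ∀ v, G.edist v r + G.edist v s = N) : G.ediam = N := by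
  refine le_antisymm (SimpleGraph.ediam_le_of_edist_le fun u v => ?_) ?_
  · have hdouble : G.edist u v + G.edist u v ≤ N + N :=
      calc G.edist u v + G.edist u v
          ≤ (G.edist u r + G.edist r v) + (G.edist u s + G.edist s v) :=
            add_le_add SimpleGraph.edist_triangle SimpleGraph.edist_triangle
        _ = (G.edist u r + G.edist u s) + (G.edist v r + G.edist v s) := by
            rw [G.edist_comm (u := r), G.edist_comm (u := s), add_add_add_comm]
        _ = N + N := by rw [h, h]
    contrapose! hdouble
    exact ENat.add_lt_add hdouble hdouble
  · calc N = G.edist r s := by rw [← h r, SimpleGraph.edist_self, zero_add]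
      _ ≤ G.ediam := SimpleGraph.edist_le_ediam

variable {D : V → ℕ}

theorem le_add_edist (hadj : ∀ u v, G.Adj u v → D u ≤ D v + 1) (u v : V) :
    (D u : ℕ∞) ≤ D v + G.edist u v := by
  by_cases hr : G.Reachable u v
  · obtain ⟨p, hp⟩ := hr.exists_walk_length_eq_edist
    rw [← hp]
    norm_cast
    clear hp hr
    induction p with
    | nil => simp
    | cons h p ih =>
      have := hadj _ _ h
      rw [SimpleGraph.Walk.length_cons]
      omega
  · simp [SimpleGraph.edist_eq_top_of_not_reachable hr]

theorem exists_edist_le_of_descent (hdesc : ∀ v, D v ≠ 0 → ∃ u, G.Adj v u ∧ D u < D v) (v : V) :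
    ∃ r, D r = 0 ∧ G.edist v r ≤ D v := by
  induction hk : D v using Nat.strong_induction_on generalizing v with
  | _ k ih =>
    subst hk
    by_cases hv : D v = 0
    · exact ⟨v, hv, by simp⟩
    · obtain ⟨u, hadj, hlt⟩ := hdesc v hv
      obtain ⟨r, hr, hle⟩ := ih _ hlt u rfl
      refine ⟨r, hr, ?_⟩
      calc G.edist v r ≤ G.edist v u + G.edist u r := SimpleGraph.edist_triangle
        _ ≤ 1 + D u := add_le_add (SimpleGraph.edist_eq_one_iff_adj.2 hadj).le hle
        _ ≤ D v := by norm_cast; omega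

theorem exists_edist_eq_of_descent [Nonempty V] (hadj : ∀ u v, G.Adj u v → D u ≤ D v + 1)
    (hdesc : ∀ v, D v ≠ 0 → ∃ u, G.Adj v u ∧ D u < D v)
    (huniq : ∀ u v, D u = 0 → D v = 0 → u = v) : ∃ r, ∀ v, G.edist v r = D v := by
  obtain ⟨r, hr, -⟩ := exists_edist_le_of_descent hdesc (Classical.arbitrary V)
  refine ⟨r, fun v => le_antisymm ?_ ?_⟩
  · obtain ⟨r', hr', hle⟩ := exists_edist_le_of_descent hdesc v
    rwa [huniq r r' hr hr']
  · simpa [hr] using le_add_edist hadj v r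

theorem ediam_eq_of_unique_extrema [Nonempty V] {N : ℕ} (hle : ∀ v, D v ≤ N)
    (hadj : ∀ u v, G.Adj u v → D u ≤ D v + 1)
    (hdesc : ∀ v, D v ≠ 0 → ∃ u, G.Adj v u ∧ D u < D v)
    (hasc : ∀ v, D v ≠ N → ∃ u, G.Adj v u ∧ D v < D u)
    (hmin : ∀ u v, D u = 0 → D v = 0 → u = v) (hmax : ∀ u v, D u = N → D v = N → u = v) :
    G.ediam = N := by
  obtain ⟨r, hr⟩ := exists_edist_eq_of_descent hadj hdesc hmin
  obtain ⟨s, hs⟩ : ∃ s, ∀ v, G.edist v s = (N - D v : ℕ) := by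
    refine exists_edist_eq_of_descent (fun u v h => ?_) (fun v hv => ?_) fun u v hu hv => ?_
    · have := hadj v u h.symm
      omega
    · obtain ⟨u, h, hlt⟩ := hasc v (by omega)
      exact ⟨u, h, by have := hle u; omega⟩
    · exact hmax u v (by have := hle u; omega) (by have := hle v; omega)
  refine ediam_eq_of_edist_add_edist_eq (r := r) (s := s) fun v => ?_
  rw [hr, hs]
  exact_mod_cast Nat.add_sub_cancel' (hle v)

end Diameter

variable {n : ℕ}

section Crossings

/-- The left one of the two positions interchanged by `simpleRefl i`. -/
def lo (i : Fin (n - 1)) : Fin n := ⟨i.val, by omega⟩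

/-- The right one of the two positions interchanged by `simpleRefl i`. -/
def hi (i : Fin (n - 1)) : Fin n := ⟨i.val + 1, by omega⟩

theorem lo_lt_hi (i : Fin (n - 1)) : lo i < hi i := by simp [lo, hi, Fin.lt_def]

theorem lo_injective : Function.Injective (lo : Fin (n - 1) → Fin n) := by
  intro i j h; simpa [lo, Fin.ext_iff] using h

theorem hi_injective : Function.Injective (hi : Fin (n - 1) → Fin n) := by
  intro i j h; simpa [hi, Fin.ext_iff] using h

@[simp] theorem simpleRefl_lo (i : Fin (n - 1)) : simpleRefl i (lo i) = hi i :=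
  Equiv.swap_apply_left _ _

@[simp] theorem simpleRefl_hi (i : Fin (n - 1)) : simpleRefl i (hi i) = lo i :=
  Equiv.swap_apply_right _ _

theorem simpleRefl_of_ne {i : Fin (n - 1)} {x : Fin n} (h₁ : x ≠ lo i) (h₂ : x ≠ hi i) :
    simpleRefl i x = x := Equiv.swap_apply_of_ne_of_ne h₁ h₂

@[simp] theorem simpleRefl_mul_self (i : Fin (n - 1)) : simpleRefl i * simpleRefl i = 1 :=
  Equiv.swap_mul_self _ _

theorem simpleRefl_lt_simpleRefl_iff {i : Fin (n - 1)} {p q : Fin n} :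
    simpleRefl i p < simpleRefl i q ↔
      (p < q ∧ ¬ (p = lo i ∧ q = hi i)) ∨ (p = hi i ∧ q = lo i) := by
  have hval : ∀ z : Fin n, (simpleRefl i z).val =
      if z.val = i.val then i.val + 1 else if z.val = i.val + 1 then i.val else z.val := by
    intro z
    simp only [simpleRefl, Equiv.swap_apply_def, Fin.ext_iff]
    split_ifs <;> rfl
  simp only [Fin.lt_def, Fin.ext_iff, hval, lo, hi]
  split_ifs <;> omega

@[simp] theorem wordProd_nil : wordProd ([] : List (Fin (n - 1))) = 1 := rfl

@[simp] theorem wordProd_cons (i : Fin (n - 1)) (w : List (Fin (n - 1))) :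
    wordProd (i :: w) = simpleRefl i * wordProd w := by simp [wordProd]

@[simp] theorem wordProd_append (v w : List (Fin (n - 1))) :
    wordProd (v ++ w) = wordProd v * wordProd w := by simp [wordProd]

/-- The values of `σ` interchanged by passing from `σ` to `σ * simpleRefl i`, in the order in
which they occur in `σ`. -/
def crossing (σ : Equiv.Perm (Fin n)) (i : Fin (n - 1)) : Fin n × Fin n := (σ (lo i), σ (hi i))

/-- The pairs of values interchanged by the successive letters of a word, starting at `σ`. In
terms of the arrangement, these are the hyperplanes crossed by the gallery of the word. -/
def crossings (σ : Equiv.Perm (Fin n)) : List (Fin (n - 1)) → List (Fin n × Fin n)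
  | [] => []
  | i :: w => crossing σ i :: crossings (σ * simpleRefl i) w

theorem crossings_append (σ : Equiv.Perm (Fin n)) (v w : List (Fin (n - 1))) :
    crossings σ (v ++ w) = crossings σ v ++ crossings (σ * wordProd v) w := by
  induction v generalizing σ with
  | nil => simp [crossings]
  | cons i v ih => simp [crossings, ih, mul_assoc]

theorem exists_of_crossings_eq_cons {σ : Equiv.Perm (Fin n)} {w : List (Fin (n - 1))}
    {p : Fin n × Fin n} {L : List (Fin n × Fin n)} (h : crossings σ w = p :: L) :
    ∃ i l, w = i :: l ∧ crossing σ i = p ∧ crossings (σ * simpleRefl i) l = L := by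
  rcases w with _ | ⟨i, w⟩
  · simp [crossings] at h
  · exact ⟨i, w, rfl, List.cons.inj h⟩

theorem exists_of_crossings_eq_append {σ : Equiv.Perm (Fin n)} {w : List (Fin (n - 1))}
    {A L : List (Fin n × Fin n)} (h : crossings σ w = A ++ L) :
    ∃ a l, w = a ++ l ∧ crossings σ a = A ∧ crossings (σ * wordProd a) l = L := by
  induction A generalizing σ w with
  | nil => exact ⟨[], w, rfl, rfl, by simpa using h⟩
  | cons p A ih =>
    obtain ⟨i, w, rfl, hi, hw⟩ := exists_of_crossings_eq_cons h
    obtain ⟨a, l, rfl, ha, hl⟩ := ih hw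
    exact ⟨i :: a, l, rfl, by simp [crossings, ha, hi], by simpa [mul_assoc] using hl⟩

theorem eq_of_map_snd_crossings_eq {σ : Equiv.Perm (Fin n)} {u v : List (Fin (n - 1))}
    (h : (crossings σ u).map Prod.snd = (crossings σ v).map Prod.snd) : u = v := by
  induction u generalizing σ v with
  | nil => cases v <;> simp_all [crossings]
  | cons i u ih =>
    rcases v with _ | ⟨j, v⟩
    · simp [crossings] at h
    · simp only [crossings, List.map_cons, List.cons.injEq] at h
      obtain rfl := hi_injective (σ.injective h.1)
      rw [ih h.2]

/-- The inversions of `σ`, as pairs of values `a < b` with `b` to the left of `a`. -/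
def inversions (σ : Equiv.Perm (Fin n)) : Finset (Fin n × Fin n) :=
  Finset.univ.filter fun p => p.1 < p.2 ∧ σ.symm p.2 < σ.symm p.1

theorem mem_inversions {σ : Equiv.Perm (Fin n)} {a b : Fin n} :
    (a, b) ∈ inversions σ ↔ a < b ∧ σ.symm b < σ.symm a := by simp [inversions]

theorem inversions_one : inversions (1 : Equiv.Perm (Fin n)) = ∅ := by
  ext ⟨a, b⟩
  simp only [mem_inversions, Finset.notMem_empty, iff_false, not_and, not_lt]
  exact le_of_lt

theorem crossing_notMem_inversions (σ : Equiv.Perm (Fin n)) (i : Fin (n - 1)) :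
    crossing σ i ∉ inversions σ := by
  simp only [crossing, mem_inversions, Equiv.symm_apply_apply, not_and, not_lt]
  exact fun _ => (lo_lt_hi i).le

theorem inversions_mul_simpleRefl {σ : Equiv.Perm (Fin n)} {i : Fin (n - 1)}
    (h : σ (lo i) < σ (hi i)) :
    inversions (σ * simpleRefl i) = insert (crossing σ i) (inversions σ) := by
  ext ⟨x, y⟩
  obtain ⟨p, rfl⟩ := σ.surjective x
  obtain ⟨q, rfl⟩ := σ.surjective y
  have hsymm : ∀ z, (σ * simpleRefl i).symm (σ z) = simpleRefl i z := by
    simp [Equiv.Perm.mul_def, simpleRefl]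
  simp only [mem_inversions, Finset.mem_insert, crossing, Prod.mk.injEq, hsymm,
    Equiv.symm_apply_apply, σ.injective.eq_iff, simpleRefl_lt_simpleRefl_iff]
  have := lo_lt_hi i
  grind

theorem card_inversions_mul_simpleRefl {σ : Equiv.Perm (Fin n)} {i : Fin (n - 1)}
    (h : σ (lo i) < σ (hi i)) :
    (inversions (σ * simpleRefl i)).card = (inversions σ).card + 1 := by
  rw [inversions_mul_simpleRefl h, Finset.card_insert_of_notMem (crossing_notMem_inversions σ i)]

theorem card_inversions_mul_simpleRefl_of_gt {σ : Equiv.Perm (Fin n)} {i : Fin (n - 1)}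
    (h : σ (hi i) < σ (lo i)) :
    (inversions (σ * simpleRefl i)).card + 1 = (inversions σ).card := by
  have h' : (σ * simpleRefl i) (lo i) < (σ * simpleRefl i) (hi i) := by simpa using h
  rw [← card_inversions_mul_simpleRefl h', mul_assoc, simpleRefl_mul_self, mul_one]

theorem card_inversions_mul_wordProd_le (σ : Equiv.Perm (Fin n)) (w : List (Fin (n - 1))) :
    (inversions (σ * wordProd w)).card ≤ (inversions σ).card + w.length := by
  induction w generalizing σ with
  | nil => simp
  | cons i w ih =>
    have hw := ih (σ * simpleRefl i)
    rw [wordProd_cons, ← mul_assoc, List.length_cons]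
    rcases lt_or_gt_of_ne (σ.injective.ne (lo_lt_hi i).ne) with h | h
    · have := card_inversions_mul_simpleRefl h
      omega
    · have := card_inversions_mul_simpleRefl_of_gt h
      omega

/-- Every letter of the word, applied successively from `σ` on, creates an inversion. -/
def Ascending (σ : Equiv.Perm (Fin n)) (w : List (Fin (n - 1))) : Prop :=
  ∀ p ∈ crossings σ w, p.1 < p.2

theorem ascending_cons {σ : Equiv.Perm (Fin n)} {i : Fin (n - 1)} {w : List (Fin (n - 1))} :
    Ascending σ (i :: w) ↔ σ (lo i) < σ (hi i) ∧ Ascending (σ * simpleRefl i) w := by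
  simp [Ascending, crossings, crossing]

theorem ascending_append {σ : Equiv.Perm (Fin n)} {v w : List (Fin (n - 1))} :
    Ascending σ (v ++ w) ↔ Ascending σ v ∧ Ascending (σ * wordProd v) w := by
  simp only [Ascending, crossings_append, List.mem_append, or_imp, forall_and]

theorem Ascending.ne {σ : Equiv.Perm (Fin n)} {j k : Fin (n - 1)} {b : List (Fin (n - 1))}
    (h : Ascending σ (j :: k :: b)) : j ≠ k := by
  rintro rfl
  simp only [ascending_cons, Equiv.Perm.mul_apply, simpleRefl_lo, simpleRefl_hi] at h
  exact h.1.not_gt h.2.1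

theorem ascending_of_card_inversions_eq {σ : Equiv.Perm (Fin n)} {w : List (Fin (n - 1))}
    (h : (inversions (σ * wordProd w)).card = (inversions σ).card + w.length) :
    Ascending σ w := by
  induction w generalizing σ with
  | nil => simp [Ascending, crossings]
  | cons i w ih =>
    rw [wordProd_cons, ← mul_assoc, List.length_cons] at h
    have hle := card_inversions_mul_wordProd_le (σ * simpleRefl i) w
    rcases lt_or_gt_of_ne (σ.injective.ne (lo_lt_hi i).ne) with hi | hi
    · have := card_inversions_mul_simpleRefl hi
      exact ascending_cons.2 ⟨hi, ih (by omega)⟩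
    · have := card_inversions_mul_simpleRefl_of_gt hi
      omega

theorem Ascending.inversions_eq {σ : Equiv.Perm (Fin n)} {w : List (Fin (n - 1))}
    (h : Ascending σ w) :
    inversions (σ * wordProd w) = inversions σ ∪ (crossings σ w).toFinset := by
  induction w generalizing σ with
  | nil => simp [crossings]
  | cons i w ih =>
    rw [ascending_cons] at h
    rw [wordProd_cons, ← mul_assoc, ih h.2, inversions_mul_simpleRefl h.1]
    simp only [crossings, List.toFinset_cons, Finset.insert_union, Finset.union_insert]

theorem Ascending.disjoint {σ : Equiv.Perm (Fin n)} {w : List (Fin (n - 1))}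
    (h : Ascending σ w) : Disjoint (inversions σ) (crossings σ w).toFinset := by
  induction w generalizing σ with
  | nil => simp [crossings]
  | cons i w ih =>
    rw [ascending_cons] at h
    have hw := ih h.2
    rw [inversions_mul_simpleRefl h.1, Finset.disjoint_insert_left] at hw
    rw [crossings, List.toFinset_cons, Finset.disjoint_insert_right]
    exact ⟨crossing_notMem_inversions σ i, hw.2⟩

theorem Ascending.nodup {σ : Equiv.Perm (Fin n)} {w : List (Fin (n - 1))} (h : Ascending σ w) :
    (crossings σ w).Nodup := by
  induction w generalizing σ with
  | nil => exact List.nodup_nil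
  | cons i w ih =>
    rw [ascending_cons] at h
    have hw := h.2.disjoint
    rw [inversions_mul_simpleRefl h.1, Finset.disjoint_insert_left] at hw
    exact List.nodup_cons.2 ⟨by simpa using hw.1, ih h.2⟩

end Crossings

section ReducedWords

variable {π : Equiv.Perm (Fin n)} {u v w : List (Fin (n - 1))}

theorem exists_descent {σ : Equiv.Perm (Fin n)} (h : σ ≠ 1) :
    ∃ i : Fin (n - 1), σ (hi i) < σ (lo i) := by
  contrapose! h
  rcases n with _ | n
  · exact Subsingleton.elim _ _
  have hmono : StrictMono σ := Fin.strictMono_iff_lt_succ.2 fun i =>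
    (h i).lt_of_ne (σ.injective.ne (lo_lt_hi (n := n + 1) i).ne)
  exact Equiv.coe_fn_injective
    ((hmono.range_inj strictMono_id).1 (by simp [σ.surjective.range_eq]))

theorem exists_wordProd_eq_and_length_eq (π : Equiv.Perm (Fin n)) :
    ∃ w, wordProd w = π ∧ w.length = (inversions π).card := by
  induction h : (inversions π).card using Nat.strong_induction_on generalizing π with
  | _ k ih =>
    by_cases hπ : π = 1
    · subst hπ
      exact ⟨[], rfl, by simp [← h, inversions_one]⟩
    · obtain ⟨i, hi⟩ := exists_descent hπ
      have hcard := card_inversions_mul_simpleRefl_of_gt hi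
      obtain ⟨w, hw, hlen⟩ := ih _ (by omega) (π * simpleRefl i) rfl
      refine ⟨w ++ [i], by simp [hw, mul_assoc], ?_⟩
      rw [List.length_append, List.length_singleton]
      omega

theorem card_inversions_le_length (w : List (Fin (n - 1))) :
    (inversions (wordProd w)).card ≤ w.length := by
  simpa [inversions_one] using card_inversions_mul_wordProd_le 1 w

theorem isReducedWord_iff :
    IsReducedWord π w ↔ wordProd w = π ∧ w.length = (inversions π).card := by
  constructor
  · rintro ⟨rfl, hmin⟩
    obtain ⟨v, hv, hlen⟩ := exists_wordProd_eq_and_length_eq (wordProd w)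
    exact ⟨rfl, le_antisymm (hlen ▸ hmin v hv) (card_inversions_le_length w)⟩
  · rintro ⟨hw, hlen⟩
    refine ⟨hw, fun v hv => ?_⟩
    rw [hlen, ← hv]
    exact card_inversions_le_length v

theorem nonempty_reducedWord (π : Equiv.Perm (Fin n)) :
    Nonempty {w : List (Fin (n - 1)) // IsReducedWord π w} := by
  obtain ⟨w, hw⟩ := exists_wordProd_eq_and_length_eq π
  exact ⟨w, isReducedWord_iff.2 hw⟩

theorem IsReducedWord.ascending (h : IsReducedWord π w) : Ascending 1 w := by
  rw [isReducedWord_iff] at h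
  apply ascending_of_card_inversions_eq
  rw [one_mul, inversions_one, Finset.card_empty, zero_add, h.1, h.2]

theorem Ascending.toFinset_crossings (h : Ascending 1 w) :
    (crossings 1 w).toFinset = inversions (wordProd w) := by
  simpa [inversions_one] using h.inversions_eq.symm

theorem IsReducedWord.toFinset_crossings (h : IsReducedWord π w) :
    (crossings 1 w).toFinset = inversions π := by
  rw [h.ascending.toFinset_crossings, h.1]

theorem IsReducedWord.eq_of_pairwise (hu : IsReducedWord π u) (hv : IsReducedWord π v)
    (r : Fin n → Fin n → Prop) [Std.Antisymm r]
    (hru : (crossings 1 u).Pairwise fun p q => r p.2 q.2)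
    (hrv : (crossings 1 v).Pairwise fun p q => r p.2 q.2) : u = v := by
  have hperm : (crossings 1 u).Perm (crossings 1 v) := by
    apply List.perm_of_nodup_nodup_toFinset_eq hu.ascending.nodup hv.ascending.nodup
    rw [hu.toFinset_crossings, hv.toFinset_crossings]
  apply eq_of_map_snd_crossings_eq (σ := 1)
  exact (hperm.map Prod.snd).eq_of_pairwise' (List.pairwise_map.2 hru) (List.pairwise_map.2 hrv)

end ReducedWords

section Moves

section Commutation

variable {j k : Fin (n - 1)} (h : j.val + 1 < k.val ∨ k.val + 1 < j.val)
include h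

theorem simpleRefl_apply_of_far : simpleRefl j (lo k) = lo k ∧ simpleRefl j (hi k) = hi k := by
  constructor <;> apply simpleRefl_of_ne <;> simp only [lo, hi, ne_eq, Fin.mk.injEq] <;> omega

theorem simpleRefl_comm : simpleRefl j * simpleRefl k = simpleRefl k * simpleRefl j := by
  ext x
  simp only [simpleRefl, Equiv.Perm.mul_apply, Equiv.swap_apply_def]
  grind

theorem crossings_comm (σ : Equiv.Perm (Fin n)) (b : List (Fin (n - 1))) :
    crossings σ (j :: k :: b) = crossing σ j :: crossing σ k ::
      crossings (σ * (simpleRefl j * simpleRefl k)) b := by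
  simp [crossings, crossing, simpleRefl_apply_of_far h, mul_assoc]

end Commutation

section Braid

variable {j k : Fin (n - 1)} (h : k.val = j.val + 1)
include h

theorem hi_eq_lo_of_succ : hi j = lo k := by simp [lo, hi, h]

theorem simpleRefl_apply_of_succ :
    simpleRefl j (lo k) = lo j ∧ simpleRefl j (hi k) = hi k ∧ simpleRefl k (lo j) = lo j := by
  refine ⟨by rw [← hi_eq_lo_of_succ h, simpleRefl_hi], ?_, ?_⟩ <;> apply simpleRefl_of_ne <;>
    simp only [lo, hi, ne_eq, Fin.mk.injEq] <;> omega

theorem simpleRefl_braid : simpleRefl j * (simpleRefl k * simpleRefl j) =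
    simpleRefl k * (simpleRefl j * simpleRefl k) := by
  ext x
  simp only [simpleRefl, Equiv.Perm.mul_apply, Equiv.swap_apply_def]
  grind

theorem crossings_pair_of_succ (σ : Equiv.Perm (Fin n)) (b : List (Fin (n - 1))) :
    crossings σ (j :: k :: b) = crossing σ j :: (σ (lo j), σ (hi k)) ::
      crossings (σ * simpleRefl j * simpleRefl k) b := by
  simp [crossings, crossing, hi_eq_lo_of_succ h, simpleRefl_apply_of_succ h]

theorem crossing_mul_pair_of_succ (σ : Equiv.Perm (Fin n)) :
    crossing (σ * simpleRefl j * simpleRefl k) j = crossing σ k := by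
  simp [crossing, hi_eq_lo_of_succ h, simpleRefl_apply_of_succ h]

theorem crossings_braid (σ : Equiv.Perm (Fin n)) (b : List (Fin (n - 1))) :
    crossings σ (j :: k :: j :: b) = crossing σ j :: (σ (lo j), σ (hi k)) :: crossing σ k ::
      crossings (σ * (simpleRefl j * (simpleRefl k * simpleRefl j))) b := by
  simp [crossings, crossing, hi_eq_lo_of_succ h, simpleRefl_apply_of_succ h, mul_assoc]

theorem crossings_braid' (σ : Equiv.Perm (Fin n)) (b : List (Fin (n - 1))) :
    crossings σ (k :: j :: k :: b) = crossing σ k :: (σ (lo j), σ (hi k)) :: crossing σ j ::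
      crossings (σ * (simpleRefl j * (simpleRefl k * simpleRefl j))) b := by
  simp [crossings, crossing, hi_eq_lo_of_succ h, simpleRefl_apply_of_succ h, simpleRefl_braid h,
    mul_assoc]

end Braid

variable {π : Equiv.Perm (Fin n)} {u v w a b : List (Fin (n - 1))} {j k : Fin (n - 1)}

theorem CommMove.wordProd_eq (h : CommMove u v) : wordProd v = wordProd u := by
  obtain ⟨a, b, j, k, hjk, rfl, rfl⟩ := h
  simp [mul_assoc, ← mul_assoc (simpleRefl j), simpleRefl_comm hjk]

theorem LongBraidMove.wordProd_eq (h : LongBraidMove u v) : wordProd v = wordProd u := by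
  obtain ⟨a, b, j, k, hjk, rfl, rfl⟩ := h
  have hbraid : wordProd [k, j, k] = wordProd [j, k, j] := by
    rcases hjk with hjk | hjk <;> simp [simpleRefl_braid hjk]
  simp only [wordProd_append, hbraid]

theorem IsReducedWord.of_move (hu : IsReducedWord π u) (h : CommMove u v ∨ LongBraidMove u v) :
    IsReducedWord π v := by
  have hprod : wordProd v = wordProd u := h.elim CommMove.wordProd_eq LongBraidMove.wordProd_eq
  have hlen : v.length = u.length := by
    rcases h with ⟨a, b, j, k, -, rfl, rfl⟩ | ⟨a, b, j, k, -, rfl, rfl⟩ <;> simp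
  exact ⟨hprod.trans hu.1, fun w hw => hlen ▸ hu.2 w hw⟩

/-- The pairs of transpositions indexing codimension two: the subspace `H_e ∩ H_f` has exactly
one such name. The subspace `x_a = x_b = x_c` with `a < b < c`, which lies on three hyperplanes,
is named by `(a, b)` and `(b, c)`, the first and the last of them to be crossed by a gallery, in
one order or the other. -/
def Precedes (e f : Fin n × Fin n) : Prop := e.2 < f.2 ∧ e.1 ≠ f.1

instance : DecidableRel (Precedes (n := n)) := fun e f =>
  inferInstanceAs (Decidable (e.2 < f.2 ∧ e.1 ≠ f.1))

instance : Std.Irrefl (Precedes (n := n)) := ⟨fun _ h => h.1.false⟩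

theorem Precedes.not_swap {e f : Fin n × Fin n} (h : Precedes e f) : ¬ Precedes f e :=
  fun h' => h.1.not_gt h'.1

/-- The pairs of inversions that name the subspaces in `L_2(σ)`. -/
def precedingPairs (σ : Equiv.Perm (Fin n)) : Finset ((Fin n × Fin n) × Fin n × Fin n) :=
  (inversions σ ×ˢ inversions σ).filter fun p => Precedes p.1 p.2

theorem mem_precedingPairs {σ : Equiv.Perm (Fin n)} {e f : Fin n × Fin n} :
    (e, f) ∈ precedingPairs σ ↔ (e ∈ inversions σ ∧ f ∈ inversions σ) ∧ Precedes e f := by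
  simp [precedingPairs]

/-- The number of pairs related by `Precedes` that a word crosses in increasing order. It is the
height function of the graph of reduced words. -/
def concordance (w : List (Fin (n - 1))) : ℕ := pairCount Precedes (crossings 1 w)

theorem concordance_comm (h : j.val + 1 < k.val ∨ k.val + 1 < j.val)
    (hlt : wordProd a (hi j) < wordProd a (hi k)) :
    concordance (a ++ [j, k] ++ b) = concordance (a ++ [k, j] ++ b) + 1 := by
  have hne : wordProd a (lo j) ≠ wordProd a (lo k) :=
    (wordProd a).injective.ne (lo_injective.ne (by rintro rfl; omega))
  have hjk : Precedes (crossing (wordProd a) j) (crossing (wordProd a) k) := ⟨hlt, hne⟩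
  simpa [concordance, crossings_append, crossings_comm h, crossings_comm h.symm,
    simpleRefl_comm h, hjk, hjk.not_swap] using
    pairCount_append_swap Precedes (crossings 1 a) (crossing (wordProd a) j)
      (crossing (wordProd a) k) (crossings (wordProd a * (simpleRefl j * simpleRefl k)) b)

theorem concordance_braid (h : k.val = j.val + 1)
    (hlt : wordProd a (lo k) < wordProd a (hi k)) :
    concordance (a ++ [j, k, j] ++ b) = concordance (a ++ [k, j, k] ++ b) + 1 := by
  have hlo : wordProd a (lo j) ≠ wordProd a (lo k) :=
    (wordProd a).injective.ne (lo_injective.ne (by rintro rfl; omega))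
  have hjk : Precedes (crossing (wordProd a) j) (crossing (wordProd a) k) :=
    ⟨by rwa [crossing, hi_eq_lo_of_succ h], hlo⟩
  have hcount := pairCount_append_reverse_three Precedes (crossings 1 a)
    (p := crossing (wordProd a) j) (q := (wordProd a (lo j), wordProd a (hi k)))
    (r := crossing (wordProd a) k)
    (crossings (wordProd a * (simpleRefl j * (simpleRefl k * simpleRefl j))) b)
    (by simp [Precedes, crossing]) (by simp [Precedes, crossing])
    (by simp [Precedes, crossing]) (by simp [Precedes, crossing])
  simpa [concordance, crossings_append, crossings_braid h, crossings_braid' h,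
    hjk, hjk.not_swap] using hcount

theorem Ascending.apply_lo_lt_apply_hi {i : Fin (n - 1)} (h : Ascending 1 (a ++ i :: b)) :
    wordProd a (lo i) < wordProd a (hi i) := by
  simpa using (ascending_cons.1 (ascending_append.1 h).2).1

theorem concordance_le_of_move (hu : Ascending 1 u) (hv : Ascending 1 v)
    (h : CommMove u v ∨ LongBraidMove u v) : concordance u ≤ concordance v + 1 := by
  rcases h with ⟨a, b, j, k, h, rfl, rfl⟩ | ⟨a, b, j, k, h, rfl, rfl⟩
  · have hne : wordProd a (hi j) ≠ wordProd a (hi k) :=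
      (wordProd a).injective.ne (hi_injective.ne (by rintro rfl; omega))
    rcases lt_or_gt_of_ne hne with hlt | hlt
    · exact (concordance_comm h hlt).le
    · have := concordance_comm (b := b) h.symm hlt
      omega
  · rcases h with h | h
    · have hk : Ascending 1 (a ++ k :: ([j, k] ++ b)) := by simpa using hv
      exact (concordance_braid h hk.apply_lo_lt_apply_hi).le
    · have hj : Ascending 1 (a ++ j :: ([k, j] ++ b)) := by simpa using hu
      have := concordance_braid (b := b) h hj.apply_lo_lt_apply_hi
      omega

end Moves

section SortedWords

variable {π σ : Equiv.Perm (Fin n)} {w a b : List (Fin (n - 1))} {j k : Fin (n - 1)}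

theorem far_or_succ_of_snd_crossing_ne (hne : j ≠ k)
    (h : (crossing σ j).2 ≠ (crossing (σ * simpleRefl j) k).2) :
    (j.val + 1 < k.val ∨ k.val + 1 < j.val) ∨ k.val = j.val + 1 := by
  by_contra! hc
  have hjk : j.val = k.val + 1 := by
    have := Fin.val_ne_of_ne hne
    omega
  simp [crossing, hi_eq_lo_of_succ hjk] at h

theorem snd_crossing_mul_simpleRefl
    (h : (j.val + 1 < k.val ∨ k.val + 1 < j.val) ∨ k.val = j.val + 1) :
    (crossing (σ * simpleRefl j) k).2 = σ (hi k) := by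
  rcases h with h | h
  · simp [crossing, simpleRefl_apply_of_far h]
  · simp [crossing, simpleRefl_apply_of_succ h]

theorem exists_eq_append_singleton_of_mem_crossings
    (hsort : (crossings σ a).Pairwise fun p q => p.2 ≤ q.2)
    (hmem : ((σ * wordProd a) (hi k), (σ * wordProd a) (lo k)) ∈ crossings σ a)
    (hle : ∀ p ∈ crossings σ a, p.2 ≤ (σ * wordProd a) (lo k)) : ∃ a', a = a' ++ [k] := by
  rcases List.eq_nil_or_concat' a with rfl | ⟨a, m, rfl⟩
  · simp [crossings] at hmem
  by_contra! hne
  have hmk : lo m ≠ lo k := lo_injective.ne fun h => hne a (h ▸ rfl)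
  generalize hz : (σ * wordProd (a ++ [m])) (lo k) = z at hmem hle
  simp only [crossings_append, crossings, List.mem_append, List.mem_singleton,
    List.pairwise_append] at hsort hmem hle
  have hm : (crossing (σ * wordProd a) m).2 = (σ * wordProd (a ++ [m])) (lo m) := by
    simp [crossing]
  have hlt : (crossing (σ * wordProd a) m).2 < z := by
    refine (hle _ (.inr rfl)).lt_of_ne ?_
    rw [hm, ← hz]
    exact (Equiv.injective _).ne hmk
  rcases hmem with hmem | hmem
  · exact (hsort.2.2 _ hmem _ rfl).not_gt hlt
  · exact hlt.ne (congrArg Prod.snd hmem).symm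

theorem exists_eq_cons_of_crossing_mem_crossings
    (hsort : (crossings σ b).Pairwise fun p q => q.2 ≤ p.2)
    (hmem : crossing σ j ∈ crossings σ b)
    (hle : ∀ p ∈ crossings σ b, p.2 ≤ (crossing σ j).2) : ∃ b', b = j :: b' := by
  rcases b with _ | ⟨m, b⟩
  · simp [crossings] at hmem
  by_contra! hne
  have hmj : hi m ≠ hi j := hi_injective.ne fun h => hne b (h ▸ rfl)
  simp only [crossings, List.mem_cons, List.pairwise_cons] at hsort hmem hle
  have hlt : (crossing σ m).2 < (crossing σ j).2 :=
    (hle _ (.inl rfl)).lt_of_ne (σ.injective.ne hmj)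
  rcases hmem with hmem | hmem
  · exact hlt.ne (congrArg Prod.snd hmem).symm
  · exact (hsort.1 _ hmem).not_gt hlt


theorem Ascending.exists_eq_append_singleton_of_succ (hw : Ascending 1 a)
    (h : k.val = j.val + 1) (hlt : wordProd a (hi k) < wordProd a (hi j))
    (hsort : (crossings 1 a ++ [crossing (wordProd a) j]).Pairwise fun p q => p.2 ≤ q.2) :
    ∃ a', a = a' ++ [k] := by
  rw [hi_eq_lo_of_succ h] at hlt
  rw [List.pairwise_append] at hsort
  refine exists_eq_append_singleton_of_mem_crossings (σ := 1) hsort.1 ?_ fun p hp => ?_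
  · rw [one_mul, ← List.mem_toFinset, hw.toFinset_crossings, mem_inversions]
    simpa using ⟨hlt, lo_lt_hi k⟩
  · simpa [crossing, hi_eq_lo_of_succ h] using hsort.2.2 p hp _ (List.mem_singleton_self _)

theorem exists_move_of_not_increasing (hw : Ascending 1 w)
    (h : ¬ (crossings 1 w).Pairwise fun p q => p.2 ≤ q.2) :
    ∃ v, (CommMove w v ∨ LongBraidMove w v) ∧ concordance v = concordance w + 1 := by
  have : IsTrans (Fin n × Fin n) fun p q => p.2 ≤ q.2 := ⟨fun _ _ _ => le_trans⟩
  rw [← List.isChain_iff_pairwise] at h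
  obtain ⟨A, p, q, B, hL, hpq, hA⟩ := exists_first_not_rel _ h
  obtain ⟨a, l, rfl, rfl, hl⟩ := exists_of_crossings_eq_append hL
  obtain ⟨j, l, rfl, rfl, hkl⟩ := exists_of_crossings_eq_cons hl
  obtain ⟨k, b, rfl, rfl, -⟩ := exists_of_crossings_eq_cons hkl
  rw [one_mul, not_le] at hpq
  rw [one_mul, List.isChain_iff_pairwise] at hA
  obtain ⟨ha, hjk⟩ := ascending_append.1 hw
  have hcases := far_or_succ_of_snd_crossing_ne hjk.ne (one_mul (wordProd a) ▸ hpq.ne')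
  rw [snd_crossing_mul_simpleRefl hcases] at hpq
  rcases hcases with hfar | hsucc
  · refine ⟨a ++ [k, j] ++ b, .inl ⟨a, b, j, k, hfar, by simp, rfl⟩, ?_⟩
    simpa using concordance_comm hfar.symm hpq
  · obtain ⟨a, rfl⟩ := ha.exists_eq_append_singleton_of_succ hsucc hpq hA
    refine ⟨a ++ [j, k, j] ++ b, .inr ⟨a, b, k, j, .inr hsucc, by simp, rfl⟩, ?_⟩
    have hk : Ascending 1 (a ++ k :: (j :: k :: b)) := by simpa using hw
    simpa using concordance_braid hsucc hk.apply_lo_lt_apply_hi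

theorem mem_inversions_of_avoids (hπ : AvoidsPattern π ![2, 3, 1]) {x y z : Fin n}
    (h : (x, z) ∈ inversions π) (hxy : x < y) (hyz : y < z) : (y, z) ∈ inversions π := by
  rw [mem_inversions] at h ⊢
  refine ⟨hyz, ?_⟩
  by_contra! hle
  have hlt : π.symm y < π.symm z := hle.lt_of_ne (π.symm.injective.ne hyz.ne)
  refine hπ ⟨![π.symm y, π.symm z, π.symm x], ?_, ?_⟩
  · refine Fin.strictMono_iff_lt_succ.2 fun i => ?_
    fin_cases i
    exacts [hlt, h.2]
  · intro i j
    fin_cases i <;> fin_cases j <;> simp [hxy.le, hyz.le, hxy, hyz, h.1.le, h.1]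

theorem IsReducedWord.exists_eq_cons_of_succ (hπ : AvoidsPattern π ![2, 3, 1])
    (hw : IsReducedWord π (a ++ j :: k :: b)) (h : k.val = j.val + 1)
    (hlt : wordProd a (hi j) < wordProd a (hi k))
    (hsort : (crossings (wordProd a * simpleRefl j) (k :: b)).Pairwise fun p q => q.2 ≤ p.2) :
    ∃ b', b = j :: b' := by
  obtain ⟨hloj, hk⟩ := ascending_cons.1 (one_mul (wordProd a) ▸ (ascending_append.1 hw.ascending).2)
  have hb := (ascending_cons.1 hk).2
  have hcrossed : (wordProd a (lo j), wordProd a (hi k)) ∈ inversions π := by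
    rw [← hw.toFinset_crossings, List.mem_toFinset, crossings_append, one_mul,
      crossings_pair_of_succ h]
    simp
  have hinv : crossing (wordProd a) k ∈ inversions π := by
    rw [crossing, ← hi_eq_lo_of_succ h]
    exact mem_inversions_of_avoids hπ hcrossed hloj hlt
  rw [crossings, List.pairwise_cons] at hsort
  rw [← hw.1] at hinv
  refine exists_eq_cons_of_crossing_mem_crossings hsort.2 ?_ fun p hp => ?_
  · have hnot := crossing_notMem_inversions (wordProd a * simpleRefl j * simpleRefl k) j
    have hunion := hb.inversions_eq
    rw [crossing_mul_pair_of_succ h] at hnot ⊢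
    simp only [mul_assoc] at hunion hnot ⊢
    simpa [hunion, hnot] using hinv
  · rw [crossing_mul_pair_of_succ h]
    exact (hsort.1 p hp).trans_eq (snd_crossing_mul_simpleRefl (.inr h))

theorem exists_move_of_not_decreasing (hπ : AvoidsPattern π ![2, 3, 1]) (hw : IsReducedWord π w)
    (h : ¬ (crossings 1 w).Pairwise fun p q => q.2 ≤ p.2) :
    ∃ v, (CommMove w v ∨ LongBraidMove w v) ∧ concordance w = concordance v + 1 := by
  have : IsTrans (Fin n × Fin n) fun p q => q.2 ≤ p.2 := ⟨fun _ _ _ h h' => h'.trans h⟩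
  rw [← List.isChain_iff_pairwise] at h
  obtain ⟨A, p, q, B, hL, hpq, hB⟩ := exists_last_not_rel _ h
  obtain ⟨a, l, rfl, rfl, hl⟩ := exists_of_crossings_eq_append hL
  obtain ⟨j, l, rfl, rfl, hkl⟩ := exists_of_crossings_eq_cons hl
  rw [one_mul] at hkl hpq
  rw [← hkl, List.isChain_iff_pairwise] at hB
  obtain ⟨k, b, rfl, rfl, -⟩ := exists_of_crossings_eq_cons hkl
  rw [not_le] at hpq
  have hne : j ≠ k := (ascending_append.1 hw.ascending).2.ne
  have hcases := far_or_succ_of_snd_crossing_ne hne hpq.ne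
  rw [snd_crossing_mul_simpleRefl hcases] at hpq
  rcases hcases with hfar | hsucc
  · refine ⟨a ++ [k, j] ++ b, .inl ⟨a, b, j, k, hfar, by simp, rfl⟩, ?_⟩
    simpa using concordance_comm (b := b) hfar hpq
  · obtain ⟨b, rfl⟩ := hw.exists_eq_cons_of_succ hπ hsucc hpq hB
    refine ⟨a ++ [k, j, k] ++ b, .inr ⟨a, b, j, k, .inl hsucc, by simp, rfl⟩, ?_⟩
    simpa using concordance_braid (b := b) hsucc (hi_eq_lo_of_succ hsucc ▸ hpq)

theorem IsReducedWord.concordance_eq_zero_iff (hw : IsReducedWord π w)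
    (hπ : AvoidsPattern π ![2, 3, 1]) :
    concordance w = 0 ↔ (crossings 1 w).Pairwise fun p q => q.2 ≤ p.2 := by
  refine ⟨fun h => ?_, fun h => ?_⟩
  · by_contra hsort
    obtain ⟨v, -, hv⟩ := exists_move_of_not_decreasing hπ hw hsort
    omega
  · exact (pairCount_eq_zero_iff _).2 (h.imp fun hle hlt => hle.not_gt hlt.1)

theorem IsReducedWord.concordance_add (hw : IsReducedWord π w) :
    concordance w + pairCount (fun e f => Precedes f e) (crossings 1 w) =
      (precedingPairs π).card := by
  rw [concordance, pairCount_add_pairCount_swap _ hw.ascending.nodup, hw.toFinset_crossings,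
    precedingPairs]

theorem IsReducedWord.concordance_le (hw : IsReducedWord π w) :
    concordance w ≤ (precedingPairs π).card :=
  hw.concordance_add ▸ Nat.le_add_right _ _

theorem IsReducedWord.concordance_eq_card_iff (hw : IsReducedWord π w) :
    concordance w = (precedingPairs π).card ↔
      (crossings 1 w).Pairwise fun p q => p.2 ≤ q.2 := by
  refine ⟨fun h => ?_, fun h => ?_⟩
  · by_contra hsort
    obtain ⟨v, hmove, hv⟩ := exists_move_of_not_increasing hw.ascending hsort
    have := (hw.of_move hmove).concordance_le
    omega
  · have hdiscordant : pairCount (fun e f => Precedes f e) (crossings 1 w) = 0 :=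
      (pairCount_eq_zero_iff _).2 (h.imp fun hle hlt => hle.not_gt hlt.1)
    rw [← hw.concordance_add, hdiscordant, add_zero]

end SortedWords

section Arrangement

theorem mem_hyperplane {i j : Fin n} {x : Fin n → ℝ} : x ∈ hyperplane i j ↔ x i = x j := Iff.rfl

theorem separates_hyperplane_iff {π : Equiv.Perm (Fin n)} {i j : Fin n} (hij : i < j) :
    Separates (hyperplane i j) (baseChamber n) (permChamber π) ↔ (i, j) ∈ inversions π := by
  rw [mem_inversions]
  constructor
  · rintro ⟨f, hf, hC, hD⟩
    refine ⟨hij, ?_⟩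
    by_contra! hle
    have hlt : π.symm i < π.symm j := hle.lt_of_ne (π.symm.injective.ne hij.ne)
    set p : Fin n → ℝ := fun x => x.val with hp
    set q : Fin n → ℝ := fun x => p (π.symm x)
    have hpC : p ∈ baseChamber n := fun x y hxy => by simpa [hp] using hxy
    have hqD : q ∈ permChamber π := ⟨p, hpC, rfl⟩
    have hpij : p i < p j := hpC hij
    have hqij : q i < q j := hpC hlt
    -- Modulo the hyperplane `p` is a positive multiple of `q`, so `f` has the same sign on both.
    have hmem : (q j - q i) • p - (p j - p i) • q ∈ LinearMap.ker f := by
      rw [hf, mem_hyperplane]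
      simp only [Pi.sub_apply, Pi.smul_apply, smul_eq_mul]
      ring
    rw [LinearMap.mem_ker, map_sub, map_smul, map_smul, smul_eq_mul, smul_eq_mul] at hmem
    nlinarith [mul_pos (sub_pos.2 hpij) (hD q hqD),
      mul_neg_of_pos_of_neg (sub_pos.2 hqij) (hC p hpC)]
  · rintro ⟨-, hlt⟩
    refine ⟨LinearMap.proj (R := ℝ) (φ := fun _ : Fin n => ℝ) i - LinearMap.proj j, ?_, ?_, ?_⟩
    · ext x
      simp [mem_hyperplane, sub_eq_zero]
    · intro x hx
      simpa using hx hij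
    · rintro _ ⟨x, hx, rfl⟩
      simpa using hx hlt

theorem apply_eq_of_inf_hyperplane_le {a b c d i j : Fin n}
    (h : hyperplane a b ⊓ hyperplane c d ≤ hyperplane i j) (x : Fin n → Fin n)
    (hab : x a = x b) (hcd : x c = x d) : x i = x j := by
  have := h (x := fun t => ((x t).val : ℝ)) ⟨by simp [mem_hyperplane, hab],
    by simp [mem_hyperplane, hcd]⟩
  simpa [mem_hyperplane, Fin.ext_iff] using this

theorem inf_hyperplane_le_hyperplane_iff {a b c d i j : Fin n} (hab : a < b) (hcd : c < d)
    (h : Precedes (a, b) (c, d)) (hij : i < j) :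
    hyperplane a b ⊓ hyperplane c d ≤ hyperplane i j ↔
      (i, j) = (a, b) ∨ (i, j) = (c, d) ∨ (b = c ∧ (i, j) = (a, d)) := by
  obtain ⟨hbd, hac⟩ := h
  dsimp only at hbd hac
  simp only [Prod.mk.injEq]
  constructor
  · intro hle
    -- Sends every coordinate to the largest one that agrees with it on `H_ab ∩ H_cd`.
    have := apply_eq_of_inf_hyperplane_le hle
      (fun t => if t = a then (if b = c then d else b) else if t = c then d else t)
      (by grind) (by grind)
    grind
  · rintro (⟨rfl, rfl⟩ | ⟨rfl, rfl⟩ | ⟨rfl, rfl, rfl⟩) x ⟨h₁, h₂⟩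
    exacts [h₁, h₂, h₁.trans h₂]

theorem hyperplane_injective {a b c d : Fin n} (hab : a < b) (hcd : c < d)
    (h : hyperplane a b = hyperplane c d) : a = c ∧ b = d := by
  have hle : hyperplane a b ⊓ hyperplane a b ≤ hyperplane c d := by rw [inf_idem, h]
  have := apply_eq_of_inf_hyperplane_le hle (fun t => if t = a then b else t)
    (by grind) (by grind)
  grind

theorem inf_hyperplane_mem_sepCodimTwo {π : Equiv.Perm (Fin n)} {a b c d : Fin n}
    (hab : (a, b) ∈ inversions π) (hcd : (c, d) ∈ inversions π) (h : Precedes (a, b) (c, d)) :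
    hyperplane a b ⊓ hyperplane c d ∈ sepCodimTwo π := by
  obtain ⟨hab_lt, hba⟩ := mem_inversions.1 hab
  obtain ⟨hcd_lt, hdc⟩ := mem_inversions.1 hcd
  refine ⟨⟨_, ⟨a, b, hab_lt, rfl⟩, _, ⟨c, d, hcd_lt, rfl⟩,
    fun heq => h.2 (hyperplane_injective hab_lt hcd_lt heq).1, rfl⟩, ?_⟩
  rintro _ ⟨i, j, hij, rfl⟩ hle
  refine ⟨⟨i, j, hij, rfl⟩, (separates_hyperplane_iff hij).2 ?_⟩
  rcases (inf_hyperplane_le_hyperplane_iff hab_lt hcd_lt h hij).1 hle with heq | heq | ⟨rfl, heq⟩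
  · rwa [heq]
  · rwa [heq]
  · rw [heq]
    exact mem_inversions.2 ⟨hab_lt.trans hcd_lt, hdc.trans hba⟩

theorem inf_hyperplane_injective {a b c d a' b' c' d' : Fin n} (hab : a < b) (hcd : c < d)
    (hab' : a' < b') (hcd' : c' < d') (h : Precedes (a, b) (c, d))
    (h' : Precedes (a', b') (c', d'))
    (heq : hyperplane a b ⊓ hyperplane c d = hyperplane a' b' ⊓ hyperplane c' d') :
    a = a' ∧ b = b' ∧ c = c' ∧ d = d' := by
  have hab_mem := (inf_hyperplane_le_hyperplane_iff hab' hcd' h' hab).1 (heq ▸ inf_le_left)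
  have hcd_mem := (inf_hyperplane_le_hyperplane_iff hab' hcd' h' hcd).1 (heq ▸ inf_le_right)
  have hab_mem' := (inf_hyperplane_le_hyperplane_iff hab hcd h hab').1 (heq ▸ inf_le_left)
  have hcd_mem' := (inf_hyperplane_le_hyperplane_iff hab hcd h hcd').1 (heq ▸ inf_le_right)
  simp only [Prod.mk.injEq, Precedes] at *
  omega

theorem exists_precedes_of_lt {a b c d : Fin n} (hab : a < b) (hcd : c < d) (hbd : b < d) :
    ∃ a' b' c' d', a' < b' ∧ c' < d' ∧ Precedes (a', b') (c', d') ∧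
      hyperplane a b ⊓ hyperplane c d = hyperplane a' b' ⊓ hyperplane c' d' := by
  by_cases hac : a = c
  · subst hac
    refine ⟨a, b, b, d, hab, hbd, ⟨hbd, hab.ne⟩, ?_⟩
    ext x
    simp only [Submodule.mem_inf, mem_hyperplane]
    grind
  · exact ⟨a, b, c, d, hab, hcd, ⟨hbd, hac⟩, rfl⟩

theorem exists_precedes {a b c d : Fin n} (hab : a < b) (hcd : c < d)
    (hne : hyperplane a b ≠ hyperplane c d) :
    ∃ a' b' c' d', a' < b' ∧ c' < d' ∧ Precedes (a', b') (c', d') ∧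
      hyperplane a b ⊓ hyperplane c d = hyperplane a' b' ⊓ hyperplane c' d' := by
  wlog hle : b < d ∨ b = d ∧ a < c generalizing a b c d
  · rw [inf_comm]
    refine this hcd hab hne.symm ?_
    grind
  rcases hle with hbd | ⟨rfl, hac⟩
  · exact exists_precedes_of_lt hab hcd hbd
  · refine ⟨a, c, c, b, hac, hcd, ⟨hcd, hac.ne⟩, ?_⟩
    ext x
    simp only [Submodule.mem_inf, mem_hyperplane]
    grind

theorem ncard_sepCodimTwo (π : Equiv.Perm (Fin n)) :
    (sepCodimTwo π).ncard = (precedingPairs π).card := by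
  rw [← Set.ncard_coe_finset]
  refine (Set.ncard_congr (fun p _ => hyperplane p.1.1 p.1.2 ⊓ hyperplane p.2.1 p.2.2)
    ?_ ?_ ?_).symm
  · rintro ⟨⟨a, b⟩, c, d⟩ h
    rw [Finset.mem_coe, mem_precedingPairs] at h
    exact inf_hyperplane_mem_sepCodimTwo h.1.1 h.1.2 h.2
  · rintro ⟨⟨a, b⟩, c, d⟩ ⟨⟨a', b'⟩, c', d'⟩ h h' heq
    simp only [Finset.mem_coe, mem_precedingPairs, mem_inversions] at h h'
    obtain ⟨rfl, rfl, rfl, rfl⟩ := inf_hyperplane_injective h.1.1.1 h.1.2.1 h'.1.1.1 h'.1.2.1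
      h.2 h'.2 heq
    rfl
  · rintro X ⟨⟨_, ⟨i, j, hij, rfl⟩, _, ⟨k, l, hkl, rfl⟩, hne, rfl⟩, hX⟩
    obtain ⟨a, b, c, d, hab, hcd, hp, heq⟩ := exists_precedes hij hkl hne
    rw [heq] at hX ⊢
    refine ⟨((a, b), (c, d)), ?_, rfl⟩
    rw [Finset.mem_coe, mem_precedingPairs]
    exact ⟨⟨(separates_hyperplane_iff hab).1 (hX _ ⟨a, b, hab, rfl⟩ inf_le_left).2,
      (separates_hyperplane_iff hcd).1 (hX _ ⟨c, d, hcd, rfl⟩ inf_le_right).2⟩, hp⟩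

end Arrangement

end RedWord

open RedWord in
theorem theorem6p6 {n : ℕ} (π : Equiv.Perm (Fin n))
    (hπ : RedWord.AvoidsPattern π ![2, 3, 1]) :
    (RedWord.reducedWordGraph π).ediam = ((RedWord.sepCodimTwo π).ncard : ℕ∞) := by
  have := nonempty_reducedWord π
  rw [ncard_sepCodimTwo]
  refine ediam_eq_of_unique_extrema (D := fun w => concordance w.1) ?_ ?_ ?_ ?_ ?_ ?_
  · exact fun w => w.2.concordance_le
  · exact fun u v h => concordance_le_of_move u.2.ascending v.2.ascending h
  · intro w hw
    obtain ⟨v, hmove, hv⟩ :=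
      exists_move_of_not_decreasing hπ w.2 (mt (w.2.concordance_eq_zero_iff hπ).2 hw)
    exact ⟨⟨v, w.2.of_move hmove⟩, hmove, by dsimp only; omega⟩
  · intro w hw
    obtain ⟨v, hmove, hv⟩ :=
      exists_move_of_not_increasing w.2.ascending (mt w.2.concordance_eq_card_iff.2 hw)
    exact ⟨⟨v, w.2.of_move hmove⟩, hmove, by dsimp only; omega⟩
  · exact fun u v hu hv => Subtype.ext <| u.2.eq_of_pairwise v.2 (· ≥ ·)
      ((u.2.concordance_eq_zero_iff hπ).1 hu) ((v.2.concordance_eq_zero_iff hπ).1 hv)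
  · exact fun u v hu hv => Subtype.ext <| u.2.eq_of_pairwise v.2 (· ≤ ·)
      (u.2.concordance_eq_card_iff.1 hu) (v.2.concordance_eq_card_iff.1 hv)
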